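/- Throughout, matroids may be infinite: a matroid $M$ on a (possibly infinite) ground set $E$ is given by a family $\mathcal{I}$ of subsets of $E$ (the independent sets) such that (I1) $\emptyset\in\mathcal{I}$; (I2) $\mathcal{I}$ is closed under taking subsets; (I3) whenever $I,I'\in\mathcal{I}$ with $I'$ maximal and $I$ not maximal in $\mathcal{I}$, there is $x\in I'\setminus I$ with $I\cup\{x\}\in\mathcal{I}$; (IM) whenever $I\subseteq X\subseteq E$ and $I\in\mathcal{I}$, the set $\{I'\in\mathcal{I} : I\subseteq I'\subseteq X\}$ has a maximal element. Bases are the maximal independent sets and circuits are the minimal dependent sets. The dual $M^*$ is the matroid on $E$ whose bases are the complements of the bases of $M$. The closure $\mathrm{cl}_M(X)$ of $X\subseteq E$ consists of $X$ together with all $e\in E\setminus X$ for which there is a circuit $C$ of $M$ with $e\in C\subseteq X\cup\{e\}$. The finitarization $M^{\mathrm{fin}}$ of $M$ is the matroid on $E$ whose circuits are exactly the finite circuits of $M$. A matroid $M$ is called nearly finitary if every base $F$ of $M^{\mathrm{fin}}$ contains a base $B$ of $M$ such that $F\setminus B$ is finite. **Corollary.** Let $M_1$ and $M_2$ be matroids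 on a common ground set $E$ such that $M_1$ is nearly finitary and $M_2$ is the dual of a nearly finitary matroid. Then $M_1$ and $M_2$ satisfy the infinite matroid intersection conjecture, that is, there is a set $I\subseteq E$ that is independent in both $M_1$ and $M_2$ and admits a partition $I=J_1\cup J_2$ into disjoint (possibly empty) sets such that $$\mathrm{cl}_{M_1}(J_1)\cup \mathrm{cl}_{M_2}(J_2)=E.$$ -/

import Mathlib

namespace Matroid

variable {α : Type*}

/-- `I` is independent in the finitarization of `M`: it is a subset of the ground set that contains
no finite circuit of `M`. -/
def FinIndep (M : Matroid α) (I : Set α) : Prop :=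
  I ⊆ M.E ∧ ∀ C : Set α, M.IsCircuit C → C.Finite → ¬ C ⊆ I

theorem finIndep_iff_indep_of_finite (M : Matroid α) {I : Set α} (hI : I.Finite) :
    M.FinIndep I ↔ M.Indep I := by
  rw [FinIndep, indep_iff_forall_subset_not_isCircuit']
  refine ⟨fun h ↦ ⟨fun C hCI hC ↦ h.2 C hC (hI.subset hCI) hCI, h.1⟩,
    fun h ↦ ⟨h.2, fun C hC _ hCI ↦ h.1 C hCI hC⟩⟩

/-- The finitarization of `M`: the matroid on the same ground set whose circuits are the
finite circuits of `M` (see `finitarization_isCircuit_iff`). -/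
def finitarization (M : Matroid α) : Matroid α :=
  (IndepMatroid.ofFinitaryCardAugment M.E M.FinIndep
    (indep_empty := (M.finIndep_iff_indep_of_finite Set.finite_empty).2 M.empty_indep)
    (indep_subset := fun _ _ hJ hIJ ↦
      ⟨hIJ.trans hJ.1, fun C hC hfin hCI ↦ hJ.2 C hC hfin (hCI.trans hIJ)⟩)
    (indep_aug := by
      intro I J hI hIfin hJ hJfin hlt
      rw [finIndep_iff_indep_of_finite _ hIfin] at hI
      rw [finIndep_iff_indep_of_finite _ hJfin] at hJ
      have hlt' : I.encard < J.encard := by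
        rw [← hIfin.cast_ncard_eq, ← hJfin.cast_ncard_eq]
        exact_mod_cast hlt
      obtain ⟨e, he, hind⟩ := hI.augment hJ hlt'
      exact ⟨e, he.1, he.2, (M.finIndep_iff_indep_of_finite (hIfin.insert e)).2 hind⟩)
    (indep_compact := by
      intro I h
      refine ⟨fun e he ↦ ?_, fun C hC hfin hCI ↦ (h C hCI hfin).2 C hC hfin subset_rfl⟩
      exact (h {e} (Set.singleton_subset_iff.2 he) (Set.finite_singleton e)).1 rfl)
    (subset_ground := fun _ h ↦ h.1)).matroid

@[simp] theorem finitarization_ground (M : Matroid α) : M.finitarization.E = M.E := rfl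

theorem finitarization_indep_iff (M : Matroid α) {I : Set α} :
    M.finitarization.Indep I ↔ I ⊆ M.E ∧ ∀ C : Set α, M.IsCircuit C → C.Finite → ¬ C ⊆ I :=
  Iff.rfl

instance finitarization_finitary (M : Matroid α) : M.finitarization.Finitary :=
  IndepMatroid.ofFinitaryCardAugment_finitary ..

theorem finitarization_isCircuit_iff (M : Matroid α) {C : Set α} :
    M.finitarization.IsCircuit C ↔ M.IsCircuit C ∧ C.Finite := by
  have key : ∀ D : Set α, D.Finite → (M.finitarization.Indep D ↔ M.Indep D) :=
    fun D hD ↦ M.finIndep_iff_indep_of_finite hD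
  have aux : C.Finite → (M.finitarization.IsCircuit C ↔ M.IsCircuit C) := by
    intro hfin
    rw [isCircuit_iff_forall_ssubset, isCircuit_iff_forall_ssubset, Dep, Dep, key C hfin]
    refine and_congr Iff.rfl (forall_congr' fun I ↦ forall_congr' fun hI ↦ ?_)
    exact key I (hfin.subset hI.subset)
  refine ⟨fun h ↦ ⟨(aux h.finite).1 h, h.finite⟩, fun h ↦ (aux h.2).2 h.1⟩

/-- `M` is nearly finitary if every base of its finitarization contains a base of `M` such that
their difference is finite. -/
def NearlyFinitary (M : Matroid α) : Prop :=
  ∀ F : Set α, M.finitarization.IsBase F → ∃ B : Set α, M.IsBase B ∧ B ⊆ F ∧ (F \ B).Finite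

/-- The conclusion of the infinite matroid intersection conjecture for `M₁` and `M₂`
(meant for matroids with the same ground set): they have a common independent set `I` with a
partition `I = J₁ ∪ J₂` (parts may be empty) such that the closure of `J₁` in `M₁` and the closure
of `J₂` in `M₂` together cover the ground set. -/
def IntersectionProperty (M₁ M₂ : Matroid α) : Prop :=
  ∃ I : Set α, M₁.Indep I ∧ M₂.Indep I ∧
    ∃ J₁ J₂ : Set α, I = J₁ ∪ J₂ ∧ Disjoint J₁ J₂ ∧
      M₁.closure J₁ ∪ M₂.closure J₂ = M₁.E

end Matroid

namespace Matroid

open Set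

variable {α : Type*} {M N M₁ M₂ : Matroid α} {A B B₁ B₂ F I J P Q U X : Set α} {e x y : α}

/-! Write `M₂ = N✶` and take bases `B₁` of `M₁`, `B₂` of `N` with maximal union. Let `A` collect all
elements that can become uncovered through chains of fundamental-circuit exchanges. By maximality
`A` misses `B₁ ∩ B₂`, and being closed under the exchanges it is spanned by `B₁ ∩ A` and by `B₂ ∩ A`
(`exists_subset_closure_inter_of_maximal_union`). Then `B₁ ∩ A` spans `A` in `M₁`, while fundamental
cocircuits show that `(B₁ \ B₂) \ A` spans the rest in `N✶`. A maximal union exists because the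
union of the two finitarizations is a matroid, by the same exchange lemma and compactness. Near
finiteness leaves only finitely much room between a union of bases and a base of that matroid. -/

theorem mem_of_mem_fundCircuit_of_ne (hyx : y ≠ x) (hy : y ∈ M.fundCircuit x B) : y ∈ B :=
  (mem_insert_iff.1 (M.fundCircuit_subset_insert x B hy)).resolve_left hyx

theorem IsBase.exchange_of_mem_fundCircuit (hB : M.IsBase B) (hx : x ∈ M.E) (hxB : x ∉ B)
    (hyx : y ≠ x) (hy : y ∈ M.fundCircuit x B) : M.IsBase (insert x B \ {y}) := by
  have hyB := mem_of_mem_fundCircuit_of_ne hyx hy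
  have hI : M.Indep (insert x B \ {y}) :=
    (hB.indep.mem_fundCircuit_iff (by rwa [hB.closure_eq]) hxB).1 hy
  rw [insert_sdiff_of_notMem _ (by simpa using hyx.symm)] at hI ⊢
  exact hB.exchange_isBase_of_indep hxB hI

/-- The circuit lies in `A`, so each of `x` and `y` is spanned by the rest of it. -/
theorem IsBase.closure_exchange_inter (hB : M.IsBase B) (hx : x ∈ M.E) (hxB : x ∉ B)
    (hyx : y ≠ x) (hy : y ∈ M.fundCircuit x B) (hA : M.fundCircuit x B ⊆ A) :
    M.closure ((insert x B \ {y}) ∩ A) = M.closure (B ∩ A) := by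
  have hC := hB.fundCircuit_isCircuit hx hxB
  have hxC := M.mem_fundCircuit x B
  have hsub := M.fundCircuit_subset_insert x B
  have hBE := hB.subset_ground
  apply subset_antisymm <;> apply closure_subset_closure_of_subset_closure
  · rintro z ⟨⟨rfl | hzB, hzy⟩, hzA⟩
    · refine M.closure_subset_closure ?_ (hC.mem_closure_sdiff_singleton_of_mem hxC)
      exact fun w hw ↦ ⟨(hsub hw.1).resolve_left hw.2, hA hw.1⟩
    · exact M.mem_closure_of_mem' ⟨hzB, hzA⟩ (hBE hzB)
  · rintro z ⟨hzB, hzA⟩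
    obtain rfl | hzy := eq_or_ne z y
    · refine M.closure_subset_closure ?_ (hC.mem_closure_sdiff_singleton_of_mem hy)
      exact fun w hw ↦ ⟨⟨hsub hw.1, hw.2⟩, hA hw.1⟩
    · exact M.mem_closure_of_mem' ⟨⟨.inr hzB, hzy⟩, hzA⟩ (hBE hzB)

/-- `ExchangeReach M₁ M₂ B₁ B₂ e P Q x` means that the pair `(P, Q)`, in which `x` is uncovered,
arises from the pair `(B₁, B₂)`, in which `e` is uncovered, by successively adding the uncovered
element to one of the two bases and removing another element of its fundamental circuit. -/
inductive ExchangeReach (M₁ M₂ : Matroid α) (B₁ B₂ : Set α) (e : α) :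
    Set α → Set α → α → Prop
  | refl : ExchangeReach M₁ M₂ B₁ B₂ e B₁ B₂ e
  | left {P Q : Set α} {x y : α} : ExchangeReach M₁ M₂ B₁ B₂ e P Q x → y ≠ x →
      y ∈ M₁.fundCircuit x P → ExchangeReach M₁ M₂ B₁ B₂ e (insert x P \ {y}) Q y
  | right {P Q : Set α} {x y : α} : ExchangeReach M₁ M₂ B₁ B₂ e P Q x → y ≠ x →
      y ∈ M₂.fundCircuit x Q → ExchangeReach M₁ M₂ B₁ B₂ e P (insert x Q \ {y}) y

theorem ExchangeReach.symm (h : ExchangeReach M₁ M₂ B₁ B₂ e P Q x) :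
    ExchangeReach M₂ M₁ B₂ B₁ e Q P x := by
  induction h with
  | refl => exact .refl
  | left _ hyx hy ih => exact ih.right hyx hy
  | right _ hyx hy ih => exact ih.left hyx hy

/-- The properties of a pair of bases that are preserved by exchanges. -/
structure ExchangeState (M₁ M₂ : Matroid α) (B₁ B₂ : Set α) (e : α) (P Q : Set α) (x : α) :
    Prop where
  left : M₁.IsBase P
  right : M₂.IsBase Q
  notMem_left : x ∉ P
  notMem_right : x ∉ Q
  insert_union : insert x (P ∪ Q) = insert e (B₁ ∪ B₂)
  inter : P ∩ Q = B₁ ∩ B₂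

theorem ExchangeState.symm (h : ExchangeState M₁ M₂ B₁ B₂ e P Q x) :
    ExchangeState M₂ M₁ B₂ B₁ e Q P x :=
  ⟨h.right, h.left, h.notMem_right, h.notMem_left, by simpa only [union_comm] using h.insert_union,
    by simpa only [inter_comm] using h.inter⟩

theorem ExchangeState.mem_ground (hE : M₁.E = M₂.E) (he : e ∈ M₁.E) (hB₁ : M₁.IsBase B₁)
    (hB₂ : M₂.IsBase B₂) (h : ExchangeState M₁ M₂ B₁ B₂ e P Q x) : x ∈ M₁.E := by
  have hx : x ∈ insert e (B₁ ∪ B₂) := h.insert_union ▸ mem_insert x _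
  obtain rfl | hx | hx := hx
  exacts [he, hB₁.subset_ground hx, hE ▸ hB₂.subset_ground hx]

theorem ExchangeState.exchange_left (hx : x ∈ M₁.E)
    (hmax : ∀ P Q, M₁.IsBase P → M₂.IsBase Q → ¬ insert e (B₁ ∪ B₂) ⊆ P ∪ Q)
    (h : ExchangeState M₁ M₂ B₁ B₂ e P Q x) (hyx : y ≠ x) (hy : y ∈ M₁.fundCircuit x P) :
    ExchangeState M₁ M₂ B₁ B₂ e (insert x P \ {y}) Q y := by
  have hyP := mem_of_mem_fundCircuit_of_ne hyx hy
  have hP' := h.left.exchange_of_mem_fundCircuit hx h.notMem_left hyx hy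
  -- Were `y` still covered by `Q`, the swap would cover `x` and lose nothing.
  have hyQ : y ∉ Q := by
    intro hyQ
    refine hmax _ _ hP' h.right ?_
    rw [← h.insert_union]
    rintro z hz
    simp only [mem_union, mem_sdiff, mem_insert_iff, mem_singleton_iff] at hz ⊢
    grind
  refine ⟨hP', h.right, by simp, hyQ, ?_, ?_⟩
  · rw [← h.insert_union]
    ext z
    simp only [mem_union, mem_sdiff, mem_insert_iff, mem_singleton_iff]
    grind
  · rw [← h.inter]
    have := h.notMem_right
    ext z
    simp only [mem_inter_iff, mem_sdiff, mem_insert_iff, mem_singleton_iff]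
    grind

theorem ExchangeReach.state (hE : M₁.E = M₂.E) (hB₁ : M₁.IsBase B₁) (hB₂ : M₂.IsBase B₂)
    (he : e ∈ M₁.E) (heB : e ∉ B₁ ∪ B₂)
    (hmax : ∀ P Q, M₁.IsBase P → M₂.IsBase Q → ¬ insert e (B₁ ∪ B₂) ⊆ P ∪ Q)
    (h : ExchangeReach M₁ M₂ B₁ B₂ e P Q x) : ExchangeState M₁ M₂ B₁ B₂ e P Q x := by
  induction h with
  | refl => exact ⟨hB₁, hB₂, fun h ↦ heB (.inl h), fun h ↦ heB (.inr h), rfl, rfl⟩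
  | left _ hyx hy ih => exact ih.exchange_left (ih.mem_ground hE he hB₁ hB₂) hmax hyx hy
  | right _ hyx hy ih =>
    refine (ih.symm.exchange_left (hE ▸ ih.mem_ground hE he hB₁ hB₂) ?_ hyx hy).symm
    exact fun P Q hP hQ hPQ ↦ hmax Q P hQ hP (by rwa [union_comm B₁, union_comm Q])

/-- The elements that become uncovered in some pair of bases that can be reached from `(B₁, B₂)`
by exchanges. -/
def exchangeSet (M₁ M₂ : Matroid α) (B₁ B₂ : Set α) : Set α :=
  {x | ∃ e ∈ M₁.E \ (B₁ ∪ B₂), ∃ P Q, ExchangeReach M₁ M₂ B₁ B₂ e P Q x}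

theorem exchangeSet_comm (hE : M₁.E = M₂.E) :
    exchangeSet M₁ M₂ B₁ B₂ = exchangeSet M₂ M₁ B₂ B₁ := by
  ext x
  simp only [exchangeSet, mem_ofPred_eq, hE, union_comm B₁ B₂]
  exact ⟨fun ⟨e, he, P, Q, h⟩ ↦ ⟨e, he, Q, P, h.symm⟩, fun ⟨e, he, P, Q, h⟩ ↦ ⟨e, he, Q, P, h.symm⟩⟩

theorem exchangeSet_subset_closure_left (hE : M₁.E = M₂.E) (hB₁ : M₁.IsBase B₁)
    (hB₂ : M₂.IsBase B₂) (hmax : ∀ e ∈ M₁.E \ (B₁ ∪ B₂), ∀ P Q, M₁.IsBase P → M₂.IsBase Q →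
      ¬ insert e (B₁ ∪ B₂) ⊆ P ∪ Q) :
    exchangeSet M₁ M₂ B₁ B₂ ⊆ M₁.closure (B₁ ∩ exchangeSet M₁ M₂ B₁ B₂) := by
  rintro x ⟨e, he, P, Q, h⟩
  have hst {P Q x} (h : ExchangeReach M₁ M₂ B₁ B₂ e P Q x) :=
    h.state hE hB₁ hB₂ he.1 he.2 (hmax e he)
  have hxE {P Q x} (h : ExchangeReach M₁ M₂ B₁ B₂ e P Q x) : x ∈ M₁.E :=
    (hst h).mem_ground hE he.1 hB₁ hB₂
  have hsub {P Q x} (h : ExchangeReach M₁ M₂ B₁ B₂ e P Q x) :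
      M₁.fundCircuit x P ⊆ exchangeSet M₁ M₂ B₁ B₂ := by
    intro y hy
    obtain rfl | hyx := eq_or_ne y x
    · exact ⟨e, he, P, Q, h⟩
    · exact ⟨e, he, _, Q, h.left hyx hy⟩
  -- Fundamental circuits along the chain stay in the exchange set, so no swap alters this closure.
  have hcl : M₁.closure (P ∩ exchangeSet M₁ M₂ B₁ B₂) =
      M₁.closure (B₁ ∩ exchangeSet M₁ M₂ B₁ B₂) := by
    induction h with
    | refl => rfl
    | left h hyx hy ih =>
      rw [← ih]
      exact (hst h).left.closure_exchange_inter (hxE h) (hst h).notMem_left hyx hy (hsub h)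
    | right _ _ _ ih => exact ih
  rw [← hcl]
  refine M₁.closure_subset_closure ?_ (((hst h).left.fundCircuit_isCircuit (hxE h)
    (hst h).notMem_left).mem_closure_sdiff_singleton_of_mem (M₁.mem_fundCircuit x P))
  exact fun y hy ↦ ⟨mem_of_mem_fundCircuit_of_ne hy.2 hy.1, hsub h hy.1⟩

/-- If the union of the bases `B₁` and `B₂` cannot be enlarged, then the uncovered elements lie in
a set on which `B₁` and `B₂` are disjoint, and which is spanned by its intersections with `B₁`
in `M₁` and with `B₂` in `M₂`. -/
theorem exists_subset_closure_inter_of_maximal_union (hE : M₁.E = M₂.E) (hB₁ : M₁.IsBase B₁)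
    (hB₂ : M₂.IsBase B₂) (hmax : ∀ e ∈ M₁.E \ (B₁ ∪ B₂), ∀ P Q, M₁.IsBase P → M₂.IsBase Q →
      ¬ insert e (B₁ ∪ B₂) ⊆ P ∪ Q) :
    ∃ A : Set α, M₁.E \ (B₁ ∪ B₂) ⊆ A ∧ Disjoint A (B₁ ∩ B₂) ∧
      A ⊆ M₁.closure (B₁ ∩ A) ∧ A ⊆ M₂.closure (B₂ ∩ A) := by
  refine ⟨exchangeSet M₁ M₂ B₁ B₂, fun e he ↦ ⟨e, he, _, _, .refl⟩, ?_,
    exchangeSet_subset_closure_left hE hB₁ hB₂ hmax, ?_⟩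
  · rw [disjoint_left]
    rintro x ⟨e, he, P, Q, h⟩ hx
    have hs := h.state hE hB₁ hB₂ he.1 he.2 (hmax e he)
    rw [← hs.inter] at hx
    exact hs.notMem_left hx.1
  · rw [exchangeSet_comm hE]
    refine exchangeSet_subset_closure_left hE.symm hB₂ hB₁ ?_
    intro e he P Q hP hQ h
    rw [union_comm B₂, ← hE] at he
    exact hmax e he Q P hQ hP (by rwa [union_comm B₁, union_comm Q])

/-! ### Unions of finitary matroids -/

/-- `X` is the union of an independent set of `M₁` and an independent set of `M₂`. -/
def UnionIndep (M₁ M₂ : Matroid α) (X : Set α) : Prop :=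
  ∃ I J, M₁.Indep I ∧ M₂.Indep J ∧ I ∪ J = X

theorem UnionIndep.subset (hJ : M₁.UnionIndep M₂ J) (hIJ : I ⊆ J) : M₁.UnionIndep M₂ I := by
  obtain ⟨K, L, hK, hL, rfl⟩ := hJ
  exact ⟨K ∩ I, L ∩ I, hK.inter_right I, hL.inter_right I,
    by rw [← union_inter_distrib_right, inter_eq_right.2 hIJ]⟩

theorem UnionIndep.exists_isBase_superset (hI : M₁.UnionIndep M₂ I) :
    ∃ P Q, M₁.IsBase P ∧ M₂.IsBase Q ∧ I ⊆ P ∪ Q := by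
  obtain ⟨K, L, hK, hL, rfl⟩ := hI
  obtain ⟨P, hP, hKP⟩ := hK.exists_isBase_superset
  obtain ⟨Q, hQ, hLQ⟩ := hL.exists_isBase_superset
  exact ⟨P, Q, hP, hQ, union_subset_union hKP hLQ⟩

/-- Compare ranks inside `A`: each `Bᵢ ∩ A` spans it, and disjointness makes their sizes add up
exactly. -/
theorem UnionIndep.encard_inter_le (hJ : M₁.UnionIndep M₂ J) (hB₁ : M₁.Indep B₁)
    (hB₂ : M₂.Indep B₂) {A : Set α} (hA : Disjoint A (B₁ ∩ B₂)) (hA₁ : A ⊆ M₁.closure (B₁ ∩ A))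
    (hA₂ : A ⊆ M₂.closure (B₂ ∩ A)) : (J ∩ A).encard ≤ ((B₁ ∪ B₂) ∩ A).encard := by
  obtain ⟨K, L, hK, hL, rfl⟩ := hJ
  have aux {M : Matroid α} {K B : Set α} (hK : M.Indep K) (hB : M.Indep B)
      (h : A ⊆ M.closure (B ∩ A)) : (K ∩ A).encard ≤ (B ∩ A).encard := by
    rw [← (hB.inter_right A).eRk_eq_encard, ← M.eRk_closure_eq]
    exact (hK.inter_right A).encard_le_eRk_of_subset (inter_subset_right.trans h)
  have hdj : Disjoint (B₁ ∩ A) (B₂ ∩ A) :=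
    disjoint_left.2 fun x hx hx' ↦ disjoint_left.1 hA hx.2 ⟨hx.1, hx'.1⟩
  rw [union_inter_distrib_right, union_inter_distrib_right, encard_union_eq hdj]
  exact (encard_union_le _ _).trans (add_le_add (aux hK hB₁ hA₁) (aux hL hB₂ hA₂))

theorem UnionIndep.augment (hI : M₁.UnionIndep M₂ I) (hJ : M₁.UnionIndep M₂ J)
    (hlt : I.encard < J.encard) :
    ∃ e ∈ J, e ∉ I ∧ M₁.UnionIndep M₂ (insert e I) := by
  by_contra! hcon
  -- Restricting to `I ∪ J` turns the failed augmentation into maximality of `I`.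
  have hres {X : Set α} : (M₁ ↾ (I ∪ J)).UnionIndep (M₂ ↾ (I ∪ J)) X ↔
      M₁.UnionIndep M₂ X ∧ X ⊆ I ∪ J := by
    refine ⟨?_, ?_⟩
    · rintro ⟨K, L, hK, hL, rfl⟩
      exact ⟨⟨K, L, hK.1, hL.1, rfl⟩, union_subset hK.2 hL.2⟩
    · rintro ⟨⟨K, L, hK, hL, rfl⟩, hss⟩
      exact ⟨K, L, ⟨hK, subset_union_left.trans hss⟩, ⟨hL, subset_union_right.trans hss⟩, rfl⟩
  have hmaxI {X : Set α} (hX : (M₁ ↾ (I ∪ J)).UnionIndep (M₂ ↾ (I ∪ J)) X) (hIX : I ⊆ X) :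
      X = I := by
    refine subset_antisymm (fun e he ↦ by_contra fun heI ↦ ?_) hIX
    refine hcon e (((hres.1 hX).2 he).resolve_left heI) heI ?_
    exact (hres.1 hX).1.subset (insert_subset he hIX)
  obtain ⟨P, Q, hP, hQ, hIPQ⟩ := (hres.2 ⟨hI, subset_union_left⟩).exists_isBase_superset
  have hPQ : P ∪ Q = I := hmaxI ⟨P, Q, hP.indep, hQ.indep, rfl⟩ hIPQ
  obtain ⟨A, hA, hdj, hA₁, hA₂⟩ := exists_subset_closure_inter_of_maximal_union
    (M₁ := M₁ ↾ (I ∪ J)) (M₂ := M₂ ↾ (I ∪ J)) rfl hP hQ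
    (fun e he P' Q' hP' hQ' hss ↦ he.2 (by
      rw [hPQ] at hss ⊢
      rw [← hmaxI ⟨P', Q', hP'.indep, hQ'.indep, rfl⟩ ((subset_insert e I).trans hss)]
      exact hss (mem_insert e I)))
  have hle := (hres.2 ⟨hJ, subset_union_right⟩).encard_inter_le hP.indep hQ.indep hdj hA₁ hA₂
  rw [hPQ] at hle hA
  refine hlt.not_ge ?_
  rw [← encard_sdiff_add_encard_inter J A, ← encard_sdiff_add_encard_inter I A]
  -- Elements of `J` outside `I` are uncovered, hence in `A`; so `J \ A ⊆ I \ A`.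
  refine add_le_add (encard_le_encard fun x hx ↦ ⟨by_contra fun hxI ↦ ?_, hx.2⟩) hle
  exact hx.2 (hA ⟨.inr hx.1, hxI⟩)

/-- Compactness: split each finite piece and take the limit of the splittings along an ultrafilter.
-/
theorem UnionIndep.of_forall_finite [M₁.Finitary] [M₂.Finitary]
    (h : ∀ Y ⊆ X, Y.Finite → M₁.UnionIndep M₂ Y) : M₁.UnionIndep M₂ X := by
  classical
  have h' (S : Finset α) : ∃ K L, M₁.Indep K ∧ M₂.Indep L ∧ K ∪ L = X ∩ S :=
    h (X ∩ S) inter_subset_left (S.finite_toSet.inter_of_right X)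
  choose K L hK hL hKL using h'
  let u : Ultrafilter (Finset α) := Ultrafilter.of Filter.atTop
  have hu {p : Finset α → Prop} (hp : ∀ᶠ S in Filter.atTop, p S) : ∀ᶠ S in (u : Filter _), p S :=
    Ultrafilter.of_le _ hp
  have aux {M : Matroid α} [M.Finitary] {f : Finset α → Set α} (hf : ∀ S, M.Indep (f S)) :
      M.Indep {x | ∀ᶠ S in (u : Filter _), x ∈ f S} := by
    refine indep_of_forall_finite_subset_indep _ fun T hT hTfin ↦ ?_
    have hev : ∀ᶠ S in (u : Filter _), ∀ x ∈ T, x ∈ f S :=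
      (Filter.eventually_all_finite hTfin).2 fun x hx ↦ hT hx
    obtain ⟨S, hS⟩ := hev.exists
    exact (hf S).subset hS
  refine ⟨_, _, aux hK, aux hL, ?_⟩
  ext x
  change ((∀ᶠ S in (u : Filter _), x ∈ K S) ∨ (∀ᶠ S in (u : Filter _), x ∈ L S)) ↔ x ∈ X
  rw [← Ultrafilter.eventually_or]
  have hx : ∀ᶠ S in (u : Filter (Finset α)), x ∈ S :=
    hu ((Filter.eventually_ge_atTop {x}).mono fun S hS ↦ hS (Finset.mem_singleton_self x))
  have key (S : Finset α) (hxS : x ∈ S) : (x ∈ K S ∨ x ∈ L S) ↔ x ∈ X := by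
    rw [← mem_union, hKL]
    simp [hxS]
  refine ⟨fun hev ↦ ?_, fun hxX ↦ hx.mono fun S hS ↦ (key S hS).2 hxX⟩
  obtain ⟨S, hS, hxS⟩ := (hev.and hx).exists
  exact (key S hxS).1 hS

/-- The union of two finitary matroids on the same ground set. -/
def finitaryUnion (M₁ M₂ : Matroid α) [M₁.Finitary] [M₂.Finitary] (hE : M₁.E = M₂.E) : Matroid α :=
  (IndepMatroid.ofFinitaryCardAugment M₁.E (M₁.UnionIndep M₂)
    (indep_empty := ⟨∅, ∅, M₁.empty_indep, M₂.empty_indep, union_self ∅⟩)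
    (indep_subset := fun _ _ hJ hIJ ↦ hJ.subset hIJ)
    (indep_aug := fun I J hI hIfin hJ hJfin hlt ↦ hI.augment hJ (by
      rw [← hIfin.cast_ncard_eq, ← hJfin.cast_ncard_eq]
      exact_mod_cast hlt))
    (indep_compact := fun _ h ↦ UnionIndep.of_forall_finite h)
    (subset_ground := by
      rintro _ ⟨K, L, hK, hL, rfl⟩
      exact union_subset hK.subset_ground (hE ▸ hL.subset_ground))).matroid

theorem finitaryUnion_indep_iff [M₁.Finitary] [M₂.Finitary] (hE : M₁.E = M₂.E) :
    (M₁.finitaryUnion M₂ hE).Indep X ↔ M₁.UnionIndep M₂ X := Iff.rfl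

/-! ### Maximal unions for nearly finitary matroids -/

theorem Indep.finitarization_indep (hI : M.Indep I) : M.finitarization.Indep I :=
  ⟨hI.subset_ground, fun _ hC _ hCI ↦ hC.not_indep (hI.subset hCI)⟩

theorem UnionIndep.finitarization (h : M₁.UnionIndep M₂ X) :
    M₁.finitarization.UnionIndep M₂.finitarization X := by
  obtain ⟨K, L, hK, hL, rfl⟩ := h
  exact ⟨K, L, hK.finitarization_indep, hL.finitarization_indep, rfl⟩

/-- Extend `J` to a base `B`: then `B \ F` and `F \ B` are equinumerous, and `F \ B` avoids `U`. -/
theorem IsBase.encard_sdiff_le_of_indep (hF : M.IsBase F) (hJ : M.Indep J)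
    (hUJ : U ⊆ J) : (J \ U).encard ≤ (F \ U).encard := by
  obtain ⟨B, hB, hJB⟩ := hJ.exists_isBase_superset
  calc (J \ U).encard ≤ ((B \ F) ∪ ((F ∩ B) \ U)).encard :=
        encard_le_encard fun x hx ↦ (em (x ∈ F)).elim (fun h ↦ .inr ⟨⟨h, hJB hx.1⟩, hx.2⟩)
          fun h ↦ .inl ⟨hJB hx.1, h⟩
    _ ≤ (F \ B).encard + ((F ∩ B) \ U).encard := by
        rw [← hB.encard_sdiff_comm hF]
        exact encard_union_le _ _
    _ = ((F \ B) ∪ ((F ∩ B) \ U)).encard :=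
        (encard_union_eq (disjoint_left.2 fun x hx hx' ↦ hx.2 hx'.1.2)).symm
    _ ≤ (F \ U).encard := encard_le_encard <| union_subset
        (sdiff_subset_sdiff_right (hUJ.trans hJB)) (sdiff_subset_sdiff_left inter_subset_left)

/-- Two nearly finitary matroids on the same ground set have bases whose union is maximal among
such unions. -/
theorem NearlyFinitary.exists_isBase_isBase_maximal_union (hE : M.E = N.E)
    (hM : M.NearlyFinitary) (hN : N.NearlyFinitary) :
    ∃ B₁ B₂, M.IsBase B₁ ∧ N.IsBase B₂ ∧ ∀ P Q, M.IsBase P → N.IsBase Q →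
      B₁ ∪ B₂ ⊆ P ∪ Q → P ∪ Q = B₁ ∪ B₂ := by
  let W : Matroid α := M.finitarization.finitaryUnion N.finitarization hE
  obtain ⟨F, hF⟩ := W.exists_isBase
  obtain ⟨F₁, F₂, hF₁, hF₂, hFss⟩ :=
    UnionIndep.exists_isBase_superset
      ((finitaryUnion_indep_iff (M₁ := M.finitarization) (M₂ := N.finitarization) hE).1 hF.indep)
  have hFeq : F = F₁ ∪ F₂ :=
    hF.eq_of_subset_indep (I := F₁ ∪ F₂) ⟨F₁, F₂, hF₁.indep, hF₂.indep, rfl⟩ hFss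
  obtain ⟨C₁, hC₁, hCF₁, hfin₁⟩ := hM F₁ hF₁
  obtain ⟨C₂, hC₂, hCF₂, hfin₂⟩ := hN F₂ hF₂
  have hfin : (F \ (C₁ ∪ C₂)).Finite := by
    refine (hfin₁.union hfin₂).subset fun x hx ↦ ?_
    rw [hFeq] at hx
    exact hx.1.imp (fun h ↦ ⟨h, fun h' ↦ hx.2 (.inl h')⟩) fun h ↦ ⟨h, fun h' ↦ hx.2 (.inr h')⟩
  let S : Set (Set α) := {X | C₁ ∪ C₂ ⊆ X ∧ ∃ P Q, M.IsBase P ∧ N.IsBase Q ∧ P ∪ Q = X}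
  have hle {X : Set α} (hX : X ∈ S) :
      (X \ (C₁ ∪ C₂)).encard ≤ (F \ (C₁ ∪ C₂)).encard := by
    obtain ⟨hCX, P, Q, hP, hQ, rfl⟩ := hX
    exact hF.encard_sdiff_le_of_indep
      (UnionIndep.finitarization ⟨P, Q, hP.indep, hQ.indep, rfl⟩) hCX
  have hXfin {X : Set α} (hX : X ∈ S) : (X \ (C₁ ∪ C₂)).Finite :=
    finite_of_encard_le_coe (k := (F \ (C₁ ∪ C₂)).ncard) (by
      rw [hfin.cast_ncard_eq]
      exact hle hX)
  let f : Set α → ℕ := fun X ↦ (X \ (C₁ ∪ C₂)).ncard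
  have hbdd : (f '' S).Finite := by
    refine (finite_Iic (F \ (C₁ ∪ C₂)).ncard).subset ?_
    rintro _ ⟨X, hX, rfl⟩
    exact ENat.toNat_le_toNat (hle hX) hfin.encard_lt_top.ne
  have hne : S.Nonempty := ⟨C₁ ∪ C₂, subset_rfl, C₁, C₂, hC₁, hC₂, rfl⟩
  -- The excess over `C₁ ∪ C₂` is bounded, so a union of largest excess exists.
  obtain ⟨X, hX, hmax⟩ := Finite.exists_maximalFor' f S hbdd hne
  obtain ⟨hCX, B₁, B₂, hB₁, hB₂, rfl⟩ := hX
  refine ⟨B₁, B₂, hB₁, hB₂, fun P Q hP hQ hss ↦ ?_⟩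
  have hPQ : P ∪ Q ∈ S := ⟨hCX.trans hss, P, Q, hP, hQ, rfl⟩
  have hss' := sdiff_subset_sdiff_left (t := C₁ ∪ C₂) hss
  have heq := eq_of_subset_of_ncard_le hss' (hmax hPQ (ncard_le_ncard hss' (hXfin hPQ)))
    (hXfin hPQ)
  refine subset_antisymm (fun x hx ↦ ?_) hss
  by_cases hxC : x ∈ C₁ ∪ C₂
  · exact hCX hxC
  · exact (heq.symm.subset ⟨hx, hxC⟩).1

/-! ### From a maximal union to the intersection property -/

/-- A matroid `M` and the dual of a matroid `N` have the intersection property if the union of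
some pair of bases of `M` and `N` is maximal. -/
theorem intersectionProperty_dual_of_maximal_union (hE : M.E = N.E) (hB₁ : M.IsBase B₁)
    (hB₂ : N.IsBase B₂) (hmax : ∀ P Q, M.IsBase P → N.IsBase Q → B₁ ∪ B₂ ⊆ P ∪ Q →
      P ∪ Q = B₁ ∪ B₂) : M.IntersectionProperty N✶ := by
  obtain ⟨A, hA, hdj, hA₁, hA₂⟩ := exists_subset_closure_inter_of_maximal_union hE hB₁ hB₂
    fun e he P Q hP hQ hss ↦ he.2 (by
      rw [← hmax P Q hP hQ ((subset_insert _ _).trans hss)]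
      exact hss (mem_insert _ _))
  have hBc : N✶.IsBase (N.E \ B₂) := hB₂.compl_isBase_dual
  have hssc : B₁ \ B₂ ⊆ N.E \ B₂ := sdiff_subset_sdiff_left (hE ▸ hB₁.subset_ground)
  have hA' : B₁ ∩ A = (B₁ \ B₂) ∩ A := by
    refine subset_antisymm (fun x hx ↦ ⟨⟨hx.1, fun h ↦ ?_⟩, hx.2⟩)
      (inter_subset_inter_left _ sdiff_subset)
    exact disjoint_left.1 hdj hx.2 ⟨hx.1, h⟩
  refine ⟨B₁ \ B₂, hB₁.indep.sdiff B₂, hBc.indep.subset hssc, B₁ ∩ A, (B₁ \ B₂) \ A, ?_, ?_, ?_⟩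
  · rw [hA', inter_union_sdiff]
  · exact disjoint_left.2 fun x hx hx' ↦ hx'.2 hx.2
  refine subset_antisymm (union_subset (M.closure_subset_ground _)
    (hE ▸ N✶.closure_subset_ground _)) fun z hz ↦ ?_
  obtain hzA | hzA := em (z ∈ A)
  · exact .inl (hA₁ hzA)
  right
  have hzN : z ∈ N✶.E := hE ▸ hz
  have hcov {y : α} (hy : y ∈ N.E) (hyA : y ∉ A) (hyB : y ∉ B₂) : y ∈ (B₁ \ B₂) \ A :=
    ⟨⟨(by_contra fun h ↦ hyA (hA ⟨hE ▸ hy, fun h' ↦ h'.elim h hyB⟩)), hyB⟩, hyA⟩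
  by_cases hzB : z ∈ B₂
  · have hC := hBc.fundCircuit_isCircuit hzN (fun h ↦ h.2 hzB)
    refine N✶.closure_subset_closure ?_
      (hC.mem_closure_sdiff_singleton_of_mem (N✶.mem_fundCircuit z _))
    rintro y ⟨hyC, hyz⟩
    have hyB := mem_of_mem_fundCircuit_of_ne hyz hyC
    refine hcov hyB.1 (fun hyA ↦ hzA ?_) hyB.2
    have hzy : z ∈ N.fundCircuit y B₂ := (hB₂.mem_fundCocircuit_iff_mem_fundCircuit).1 hyC
    have hycl := hA₂ hyA
    -- Since `B₂ ∩ A` already spans `y`, its fundamental circuit meets `B₂` only inside `A`, which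
    -- forces `z ∈ A`.
    have hC' : N.fundCircuit y (B₂ ∩ A) = N.fundCircuit y B₂ :=
      ((hB₂.indep.inter_right A).fundCircuit_isCircuit hycl (fun h ↦ hyB.2 h.1)
        ).eq_fundCircuit_of_subset hB₂.indep ((N.fundCircuit_subset_insert y _).trans
          (insert_subset_insert inter_subset_left))
    rw [← hC'] at hzy
    exact (mem_of_mem_fundCircuit_of_ne (Ne.symm hyz) hzy).2
  · exact N✶.mem_closure_of_mem' (hcov hzN hzA hzB) hzN

end Matroid

theorem mainTheorem3 {α : Type*} (M₁ M₂ : Matroid α) (hE : M₁.E = M₂.E)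
    (h₁ : M₁.NearlyFinitary) (h₂ : ∃ N : Matroid α, N.NearlyFinitary ∧ M₂ = N.dual) :
    M₁.IntersectionProperty M₂ := by
  obtain ⟨N, hN, rfl⟩ := h₂
  have hE' : M₁.E = N.E := hE
  obtain ⟨B₁, B₂, hB₁, hB₂, hmax⟩ := h₁.exists_isBase_isBase_maximal_union hE' hN
  exact Matroid.intersectionProperty_dual_of_maximal_union hE' hB₁ hB₂ hmax
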